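/- For $z\in\mathbb{C}$ with $0<|z|<1$ let $f(x)=zx$ and $g(x)=z(x-1)+1$, let $\Lambda_z\subset\mathbb{C}$ be the limit set of the semigroup generated by $f$ and $g$ (the closure of the set of fixed points of its elements), and let $\mathcal{M}$ be the set of all such $z$ for which $\Lambda_z$ is connected. A finite word $u$ in the letters $f,g$ is also regarded as the corresponding composition of the maps $f$ and $g$ (the first letter is applied last), and $uX$ denotes the image of a set $X$ under it. Let $D\subset\mathbb{C}$ be a closed topological disk that contains $\Lambda_z$ in its interior. A pair of finite words $u,v$ is a trap for $(z,D)$ if (1) $u$ starts with $f$ and $v$ starts with $g$; (2) there are points $p^{\pm}\in u\Lambda_z\setminus vD$ and $q^{\pm}\in v\Lambda_z\setminus uD$, a path $\alpha\subseteq uD$ with endpoints $p^{\pm}$ and a path $\beta\subseteq vD$ with endpoints $q^{\pm}$, such that the algebraic intersection number of $\alpha$ and $\beta$ is nonzero; (3) for some $\epsilon>0$ such that the $\epsilon/2$-neighborhood of $\Lambda_z$ is contained in $D$, there are a point of $f\Lambda_z$ and a point of $g\Lambda_z$ at distance at most $\epsilon$ from each other. Proposition (Traps in $\mathcal{M}$).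 Let $0<|z|<1$ and let $u,v$ be a trap for $(z,D)$, for some closed topological disk $D$ containing $\Lambda_z$ in its interior. Then $z$ lies in the interior of $\mathcal{M}$. -/

import Mathlib

namespace IFSTraps

open Set Metric

/-! ### The semigroup `G_z`, its limit set, and the connectedness locus -/

/-- The two letters `f`, `g` of the alphabet. -/
inductive Letter
  | f
  | g

/-- The generators `f : x ↦ z x` and `g : x ↦ z (x - 1) + 1`. -/
def gen (z : ℂ) : Letter → ℂ → ℂ
  | Letter.f => fun x => z * x
  | Letter.g => fun x => z * (x - 1) + 1

/-- The map `x ↦ u(z, x)` of a finite word `u`: the composition of the generators, in the order in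
which they are written, so that `(a u)(z, x) = a(z, u(z, x))`. -/
def wordMap (z : ℂ) : List Letter → ℂ → ℂ
  | [] => id
  | a :: u => gen z a ∘ wordMap z u

/-- The limit set `Λ_z` of the semigroup `G_z` generated by `f` and `g`: the closure of the set of
fixed points of elements of `G_z`. -/
def limitSet (z : ℂ) : Set ℂ :=
  closure {x | ∃ u : List Letter, u ≠ [] ∧ wordMap z u x = x}

/-- The connectedness locus `M`: the parameters `z` with `0 < |z| < 1` whose limit set is
connected. -/
def connectednessLocus : Set ℂ :=
  {z | 0 < ‖z‖ ∧ ‖z‖ < 1 ∧ IsConnected (limitSet z)}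

/-! ### Algebraic intersection numbers of plane paths -/

/-- `n` is the winding number about `0` of the loop `γ`: the loop has a continuous logarithm `θ`
whose total increment is `2πi n`. -/
def IsWindingNumber {w : ℂ} (γ : Path w w) (n : ℤ) : Prop :=
  ∃ θ : C(unitInterval, ℂ), (∀ t, Complex.exp (θ t) = γ t) ∧
    θ 1 - θ 0 = n * (2 * Real.pi * Complex.I)

theorem IsWindingNumber.unique {w : ℂ} {γ : Path w w} {m n : ℤ}
    (hm : IsWindingNumber γ m) (hn : IsWindingNumber γ n) : m = n := by
  obtain ⟨θ, hθ, h1⟩ := hm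
  obtain ⟨η, hη, h2⟩ := hn
  have hpi : (2 * Real.pi * Complex.I : ℂ) ≠ 0 := Complex.two_pi_I_ne_zero
  obtain ⟨k, hk⟩ := Complex.exp_eq_exp_iff_exists_int.1 ((hθ 0).trans (hη 0).symm)
  have key : ∀ t, θ t = η t + k * (2 * Real.pi * Complex.I) := by
    let η' : C(unitInterval, ℂ) := η + ContinuousMap.const _ (k * (2 * Real.pi * Complex.I))
    have hγ : ∀ t, γ t ≠ 0 := fun t => hθ t ▸ Complex.exp_ne_zero _
    have := Complex.isCoveringMap_exp.eq_of_comp_eq (g₁ := θ) (g₂ := η') θ.continuous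
      η'.continuous (by
        funext t
        apply Subtype.ext
        change Complex.exp (θ t) = Complex.exp (η t + k * (2 * Real.pi * Complex.I))
        rw [hθ, Complex.exp_add, Complex.exp_int_mul_two_pi_mul_I, mul_one, hη]) 0 hk
    exact fun t => congrFun this t
  have h3 : (m : ℂ) * (2 * Real.pi * Complex.I) = n * (2 * Real.pi * Complex.I) := by
    rw [← h1, ← h2, key 0, key 1]; ring
  exact_mod_cast mul_right_cancel₀ hpi h3

theorem exists_isWindingNumber {w : ℂ} (γ : Path w w) (hγ : ∀ t, γ t ≠ 0) :
    ∃ n, IsWindingNumber γ n := by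
  let γ' : C(unitInterval, {z : ℂ // z ≠ 0}) :=
    ⟨fun t => ⟨γ t, hγ t⟩, by fun_prop⟩
  have hw : w ≠ 0 := by simpa using hγ 0
  obtain ⟨θ, hθ, -⟩ := Complex.isCoveringMap_exp.exists_path_lifts γ' (Complex.log w) (by
    apply Subtype.ext
    change γ 0 = Complex.exp (Complex.log w)
    rw [Complex.exp_log hw, γ.source])
  have hθ' : ∀ t, Complex.exp (θ t) = γ t := fun t => congrArg Subtype.val (congrFun hθ t)
  obtain ⟨n, hn⟩ := Complex.exp_eq_exp_iff_exists_int.1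
    (show Complex.exp (θ 1) = Complex.exp (θ 0) by rw [hθ', hθ', γ.source, γ.target])
  exact ⟨n, θ, hθ', by rw [hn]; ring⟩

open Classical in
/-- The winding number about `0` of a loop in `ℂ` that avoids `0`
(and, by convention, `0` for a loop through `0`). -/
noncomputable def windingNumber {w : ℂ} (γ : Path w w) : ℤ :=
  if h : ∃ n, IsWindingNumber γ n then h.choose else 0

theorem isWindingNumber_windingNumber {w : ℂ} (γ : Path w w) (hγ : ∀ t, γ t ≠ 0) :
    IsWindingNumber γ (windingNumber γ) := by
  have h := exists_isWindingNumber γ hγ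
  rw [windingNumber, dif_pos h]
  exact h.choose_spec

/-- The restriction of `(s, t) ↦ α s - β t` to the boundary of the unit square, traversed through
the corners `(0,0)`, `(0,1)`, `(1,1)`, `(1,0)`, `(0,0)` in this order. -/
noncomputable def differenceLoop {p p' q q' : ℂ} (α : Path p p') (β : Path q q') : Path (p - q) (p - q) :=
  (((β.map (f := fun y => p - y) (by fun_prop)).trans
    (α.map (f := fun x => x - q') (by fun_prop))).trans
    (β.map (f := fun y => p' - y) (by fun_prop)).symm).trans
    (α.map (f := fun x => x - q) (by fun_prop)).symm

/-- The algebraic intersection number `α · β` of two paths in the oriented plane such that no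
endpoint of either path lies on the other one: the degree over `0` of the map
`(s, t) ↦ α s - β t` of the unit square, that is, the winding number about `0` of its restriction
to the boundary. The direction in which the boundary is traversed is such that a transverse
crossing counts `+1` if the tangent vectors of `α` and `β` form a positively oriented basis, and
`-1` otherwise; for paths in general position this is the signed number of crossings. -/
noncomputable def algebraicIntersectionNumber {p p' q q' : ℂ} (α : Path p p') (β : Path q q') : ℤ :=
  windingNumber (differenceLoop α β)

/-! ### Traps -/

/-- A closed topological disk in the plane. -/
def IsClosedTopologicalDisk (D : Set ℂ) : Prop :=
  Nonempty (D ≃ₜ closedBall (0 : ℂ) 1)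

/-- The pair of finite words `u`, `v` is a trap for `(z, D)`. -/
structure IsTrap (z : ℂ) (D : Set ℂ) (u v : List Letter) : Prop where
  isDisk : IsClosedTopologicalDisk D
  limitSet_subset : limitSet z ⊆ interior D
  /-- `u` starts with `f`. -/
  left_start : ∃ u', u = Letter.f :: u'
  /-- `v` starts with `g`. -/
  right_start : ∃ v', v = Letter.g :: v'
  /-- There are points `p⁺, p⁻ ∈ uΛ_z - vD` and `q⁺, q⁻ ∈ vΛ_z - uD`, a path `α` in `uD` between
  `p⁻` and `p⁺` and a path `β` in `vD` between `q⁻` and `q⁺`, whose algebraic intersection number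
  is nonzero. -/
  crossing : ∃ pm ∈ (wordMap z u '' limitSet z) \ (wordMap z v '' D),
    ∃ pp ∈ (wordMap z u '' limitSet z) \ (wordMap z v '' D),
    ∃ qm ∈ (wordMap z v '' limitSet z) \ (wordMap z u '' D),
    ∃ qp ∈ (wordMap z v '' limitSet z) \ (wordMap z u '' D),
    ∃ (α : Path pm pp) (β : Path qm qp),
      range α ⊆ wordMap z u '' D ∧ range β ⊆ wordMap z v '' D ∧
        algebraicIntersectionNumber α β ≠ 0
  /-- There are points of `fΛ_z` and `gΛ_z` within distance `ε` of each other, where the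
  `ε/2`-neighborhood of `Λ_z` is contained in `D`. -/
  close : ∃ ε : ℝ, 0 < ε ∧ thickening (ε / 2) (limitSet z) ⊆ D ∧
    ∃ x ∈ gen z Letter.f '' limitSet z, ∃ y ∈ gen z Letter.g '' limitSet z, dist x y ≤ ε

end IFSTraps

/-!
Write `Λ` for `Λ_z` and let `δ` be the distance between `fΛ` and `gΛ`, which together make up `Λ`.
Starting from `diam Λ` and applying self-similarity repeatedly, one sees that any two points of `Λ`
are joined by a path in the `δ/2`-neighborhood of `Λ`; for a trap this neighborhood lies in `D`.
The trap forces the images under `u` and `v` of two such paths to meet. A common point is within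
`|z| δ/2` of `uΛ ⊆ fΛ` and of `vΛ ⊆ gΛ`, so `δ ≤ |z| δ`, hence `δ = 0`; and `Λ` is connected as
soon as `fΛ` meets `gΛ`.

The crossing survives small changes of `z` and of the endpoints: retracting the plane onto `D` turns
straight-line interpolation into a homotopy inside `D` which keeps the endpoints of each path off
the other image of `D`, and such a homotopy preserves the intersection number. Since `Λ` is lower
and upper hemicontinuous in `z`, the argument above applies at every nearby parameter.
-/

namespace IFSTraps

open Set Metric Filter Topology unitInterval
open scoped NNReal

/-! ### Continuous logarithms and winding numbers -/

instance : LocallyPathConnectedSpace I :=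
  (isQuotientMap_projIcc (h := zero_le_one (α := ℝ))).locallyPathConnectedSpace

instance : ContractibleSpace I :=
  (convex_Icc 0 1).contractibleSpace (nonempty_Icc.2 zero_le_one)

section Logarithm

variable {X : Type*} [TopologicalSpace X]

theorem exists_continuousMap_exp_eq [SimplyConnectedSpace X] [LocallyPathConnectedSpace X]
    (f : C(X, ℂ)) (hf : ∀ x, f x ≠ 0) : ∃ θ : C(X, ℂ), ∀ x, Complex.exp (θ x) = f x := by
  let f' : C(X, {w : ℂ // w ≠ 0}) := ⟨fun x => ⟨f x, hf x⟩, by fun_prop⟩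
  obtain ⟨x₀⟩ : Nonempty X := inferInstance
  obtain ⟨θ, ⟨-, hθ⟩, -⟩ := Complex.isCoveringMap_exp.existsUnique_continuousMap_lifts f' x₀
    (Complex.log (f x₀)) (Subtype.ext (Complex.exp_log (hf x₀)))
  exact ⟨θ, fun x => congrArg Subtype.val (congrFun hθ x)⟩

theorem sub_eq_sub_of_exp_eq_exp [PreconnectedSpace X] {θ η : C(X, ℂ)}
    (h : ∀ x, Complex.exp (θ x) = Complex.exp (η x)) (x y : X) : θ x - θ y = η x - η y := by
  obtain ⟨k, hk⟩ := Complex.exp_eq_exp_iff_exists_int.1 (h y)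
  have hlift : (θ : X → ℂ) = fun x => η x + k * (2 * Real.pi * Complex.I) :=
    Complex.isCoveringMap_exp.eq_of_comp_eq θ.continuous (by fun_prop) (funext fun t =>
      Subtype.ext (by simp [Complex.exp_add, Complex.exp_int_mul_two_pi_mul_I, h])) y hk
  rw [hlift]
  ring

end Logarithm

theorem IsWindingNumber.windingNumber_eq {w : ℂ} {γ : Path w w} {n : ℤ}
    (h : IsWindingNumber γ n) : windingNumber γ = n := by
  obtain ⟨θ, hθ, -⟩ := id h
  exact (isWindingNumber_windingNumber γ fun t => hθ t ▸ Complex.exp_ne_zero _).unique h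

theorem windingNumber_eq_of_homotopy {w w' : ℂ} {γ : Path w w} {γ' : Path w' w'}
    (H : (γ : C(I, ℂ)).Homotopy γ') (hloop : ∀ τ, H (τ, 0) = H (τ, 1)) (hH : ∀ x, H x ≠ 0) :
    windingNumber γ = windingNumber γ' := by
  obtain ⟨Θ, hΘ⟩ := exists_continuousMap_exp_eq H.toContinuousMap hH
  obtain ⟨θ, hθ, hincr⟩ := isWindingNumber_windingNumber γ' fun t => by
    simpa using hH (1, t)
  have hside : Θ (0, 1) - Θ (1, 1) = Θ (0, 0) - Θ (1, 0) :=
    sub_eq_sub_of_exp_eq_exp (θ := ⟨fun τ => Θ (τ, 1), by fun_prop⟩)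
      (η := ⟨fun τ => Θ (τ, 0), by fun_prop⟩) (fun τ => by simpa [hΘ] using (hloop τ).symm) 0 1
  have htop : Θ (1, 1) - Θ (1, 0) = θ 1 - θ 0 :=
    sub_eq_sub_of_exp_eq_exp (θ := ⟨fun t => Θ (1, t), by fun_prop⟩) (fun t => by simp [hΘ, hθ]) 1 0
  refine IsWindingNumber.windingNumber_eq ⟨⟨fun t => Θ (0, t), by fun_prop⟩, fun t => ?_, ?_⟩
  · simp [hΘ]
  · change Θ (0, 1) - Θ (0, 0) = _
    rw [← hincr]
    linear_combination hside + htop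

/-! ### Intersection numbers -/

/-- The loop along which `differenceLoop` traverses the boundary of the unit square:
`(0,0)`, `(0,1)`, `(1,1)`, `(1,0)`, `(0,0)`. -/
noncomputable def squareBoundary : Path ((0, 0) : I × I) (0, 0) :=
  let ι : Path (0 : I) 1 := ⟨ContinuousMap.id I, rfl, rfl⟩
  ((((Path.refl 0).trans ι).trans (Path.refl 1)).trans ι.symm).prod
    (((ι.trans (Path.refl 1)).trans ι.symm).trans (Path.refl 0))

theorem squareBoundary_mem (r : I) : (squareBoundary r).1 = 0 ∨ (squareBoundary r).1 = 1 ∨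
    (squareBoundary r).2 = 0 ∨ (squareBoundary r).2 = 1 := by
  simp only [squareBoundary, Path.prod_coe, Path.trans_apply]
  split_ifs <;> simp

section IntersectionNumber

variable {p p' q q' r r' s s' : ℂ} {α : Path p p'} {β : Path q q'} {α' : Path r r'} {β' : Path s s'}

theorem differenceLoop_apply (α : Path p p') (β : Path q q') (t : I) :
    differenceLoop α β t = α (squareBoundary t).1 - β (squareBoundary t).2 := by
  simp only [squareBoundary, Path.prod_coe, Path.trans_apply, differenceLoop]
  split_ifs <;> simp [Path.symm_apply] <;> rfl

theorem algebraicIntersectionNumber_eq_of_homotopy (A : (α : C(I, ℂ)).Homotopy α')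
    (B : (β : C(I, ℂ)).Homotopy β')
    (hAB : ∀ τ s t, (s = 0 ∨ s = 1 ∨ t = 0 ∨ t = 1) → A (τ, s) ≠ B (τ, t)) :
    algebraicIntersectionNumber α β = algebraicIntersectionNumber α' β' := by
  refine windingNumber_eq_of_homotopy
    { toFun := fun x => A (x.1, (squareBoundary x.2).1) - B (x.1, (squareBoundary x.2).2)
      map_zero_left := fun t => by simp [differenceLoop_apply]
      map_one_left := fun t => by simp [differenceLoop_apply] } (fun τ => ?_) fun x => ?_
  · change A (τ, (squareBoundary 0).1) - B (τ, (squareBoundary 0).2) =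
      A (τ, (squareBoundary 1).1) - B (τ, (squareBoundary 1).2)
    rw [squareBoundary.source, squareBoundary.target]
  · exact sub_ne_zero.2 (hAB _ _ _ (squareBoundary_mem x.2))

theorem algebraicIntersectionNumber_eq_zero_of_disjoint (h : Disjoint (range α) (range β)) :
    algebraicIntersectionNumber α β = 0 := by
  obtain ⟨Φ, hΦ⟩ := exists_continuousMap_exp_eq
    (⟨fun x => α x.1 - β x.2, by fun_prop⟩ : C(I × I, ℂ)) fun x =>
      sub_ne_zero.2 (disjoint_iff_forall_ne.1 h (mem_range_self _) (mem_range_self _))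
  refine IsWindingNumber.windingNumber_eq
    ⟨Φ.comp squareBoundary, fun t => by simp [hΦ, differenceLoop_apply], by simp⟩

end IntersectionNumber

/-! ### Stable crossings -/

/-- Any path in `D` between the points of `a` and any path in `D` between the points of `b` have
intersecting images under `U` and `V`, respectively. This is what a trap provides and, unlike an
intersection number, it does not refer to particular paths. -/
def PathsCross {X Y : Type*} [TopologicalSpace X] (U V : X → Y) (D : Set X) (a b : X × X) : Prop :=
  ∀ (α : Path a.1 a.2) (β : Path b.1 b.2), range α ⊆ D → range β ⊆ D → ∃ s t, U (α s) = V (β t)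

theorem PathsCross.mono {X Y : Type*} [TopologicalSpace X] {U V : X → Y} {C D : Set X}
    {a b : X × X} (h : PathsCross U V D a b) (hCD : C ⊆ D) : PathsCross U V C a b :=
  fun α β hα hβ => h α β (hα.trans hCD) (hβ.trans hCD)

theorem exists_path_map_eq_of_isEmbedding {X Y : Type*} [TopologicalSpace X] [TopologicalSpace Y]
    {φ : X → Y} (hφ : IsEmbedding φ) {D : Set X} {x y : X} (α : Path (φ x) (φ y))
    (hα : range α ⊆ φ '' D) : ∃ a : Path x y, range a ⊆ D ∧ a.map hφ.continuous = α := by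
  choose a haD ha using fun s => hα (mem_range_self s)
  refine ⟨⟨⟨a, hφ.continuous_iff.2 (by simpa only [Function.comp_def, ha] using α.continuous)⟩,
    hφ.injective (by simp [ha]), hφ.injective (by simp [ha])⟩, ?_, Path.ext (funext ha)⟩
  rintro _ ⟨s, rfl⟩
  exact haD s

theorem isOpen_setOf_notMem_image {Q X Y : Type*} [TopologicalSpace Q] [TopologicalSpace X]
    [TopologicalSpace Y] [T2Space Y] {D : Set X} (hD : IsCompact D) {f : Q → Y}
    (hf : Continuous f) {G : Q → X → Y} (hG : Continuous ↿G) : IsOpen {w | f w ∉ G w '' D} := by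
  refine isOpen_iff_eventually.2 fun w hw => ?_
  have hev := hD.eventually_forall_of_forall_eventually (x₀ := w) (P := fun w x => f w ≠ G w x)
    fun x hx => (isOpen_ne_fun (hf.comp continuous_fst) hG).mem_nhds
      fun h => hw ⟨x, hx, h.symm⟩
  filter_upwards [hev] with w' hw' ⟨x, hx, hwx⟩
  exact hw' x hx hwx.symm

section Stability

variable {P E : Type*} [NormedAddCommGroup P] [NormedSpace ℝ P]
  [NormedAddCommGroup E] [NormedSpace ℝ E] {D : Set E} {U V : P → E → ℂ}

theorem eventually_forall_lineMap_notMem_image (hU : Continuous ↿U) (hV : Continuous ↿V)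
    (hD : IsCompact D) {R : C(E, D)} (hR : ∀ x : D, R x = x) {z : P} {x : E} (hx : x ∈ D)
    (hUV : U z x ∉ V z '' D) : ∀ᶠ w : P × E in 𝓝 (z, x), ∀ τ : I,
      U (AffineMap.lineMap z w.1 (τ : ℝ)) (R (AffineMap.lineMap x w.2 (τ : ℝ))) ∉
        V (AffineMap.lineMap z w.1 (τ : ℝ)) '' D := by
  have hopen : IsOpen {w : P × E | U w.1 (R w.2) ∉ V w.1 '' D} :=
    isOpen_setOf_notMem_image hD (f := fun w : P × E => U w.1 (R w.2))
      (hU.comp (g := ↿U) (f := fun w : P × E => (w.1, (R w.2 : E))) (by fun_prop))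
      (hV.comp (g := ↿V) (f := fun w : (P × E) × E => (w.1.1, w.2)) (by fun_prop))
  have hmem : (z, x) ∈ {w : P × E | U w.1 (R w.2) ∉ V w.1 '' D} := by
    have : (R x : E) = x := congrArg Subtype.val (hR ⟨x, hx⟩)
    simpa [this] using hUV
  obtain ⟨ρ, hρ, hball⟩ := Metric.isOpen_iff.1 hopen _ hmem
  filter_upwards [ball_mem_nhds _ hρ] with w hw τ
  have := hball ((convex_ball _ _).lineMap_mem (mem_ball_self hρ) hw τ.2)
  simpa [AffineMap.lineMap_apply] using this

theorem exists_homotopy_retract_lineMap (hU : Continuous ↿U) {R : C(E, D)} (hR : ∀ x : D, R x = x)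
    (z z' : P) {x y x' y' : E} {α : Path x y} {α' : Path x' y'} (hα : range α ⊆ D)
    (hα' : range α' ⊆ D) :
    ∃ A : (α.map (hU.uncurry_left z) : C(I, ℂ)).Homotopy (α'.map (hU.uncurry_left z')),
      ∀ τ s, A (τ, s) =
        U (AffineMap.lineMap z z' (τ : ℝ)) (R (AffineMap.lineMap (α s) (α' s) (τ : ℝ))) := by
  have hRD : ∀ w ∈ D, (R w : E) = w := fun w hw => congrArg Subtype.val (hR ⟨w, hw⟩)
  have hcont : Continuous fun q : I × I => (AffineMap.lineMap z z' (q.1 : ℝ),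
      (R (AffineMap.lineMap (α q.2) (α' q.2) (q.1 : ℝ)) : E)) := by
    simp only [AffineMap.lineMap_apply]
    fun_prop
  exact ⟨⟨⟨_, hU.comp hcont⟩, fun s => by
      simp [Function.HasUncurry.uncurry, hRD _ (hα (mem_range_self s))],
    fun s => by
      simp [Function.HasUncurry.uncurry, hRD _ (hα' (mem_range_self s))]⟩, fun τ s => rfl⟩

theorem pathsCross_of_lineMap_notMem_image (hU : Continuous ↿U) (hV : Continuous ↿V) {R : C(E, D)}
    (hR : ∀ x : D, R x = x) {z z' : P} {a₀ a₁ b₀ b₁ a₀' a₁' b₀' b₁' : E} {α : Path a₀ a₁}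
    {β : Path b₀ b₁} (hα : range α ⊆ D) (hβ : range β ⊆ D)
    (ha₀ : ∀ τ : I, U (AffineMap.lineMap z z' (τ : ℝ)) (R (AffineMap.lineMap a₀ a₀' (τ : ℝ))) ∉
      V (AffineMap.lineMap z z' (τ : ℝ)) '' D)
    (ha₁ : ∀ τ : I, U (AffineMap.lineMap z z' (τ : ℝ)) (R (AffineMap.lineMap a₁ a₁' (τ : ℝ))) ∉
      V (AffineMap.lineMap z z' (τ : ℝ)) '' D)
    (hb₀ : ∀ τ : I, V (AffineMap.lineMap z z' (τ : ℝ)) (R (AffineMap.lineMap b₀ b₀' (τ : ℝ))) ∉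
      U (AffineMap.lineMap z z' (τ : ℝ)) '' D)
    (hb₁ : ∀ τ : I, V (AffineMap.lineMap z z' (τ : ℝ)) (R (AffineMap.lineMap b₁ b₁' (τ : ℝ))) ∉
      U (AffineMap.lineMap z z' (τ : ℝ)) '' D)
    (h : algebraicIntersectionNumber (α.map (hU.uncurry_left z)) (β.map (hV.uncurry_left z)) ≠ 0) :
    PathsCross (U z') (V z') D (a₀', a₁') (b₀', b₁') := by
  intro α' β' hα' hβ'
  obtain ⟨A, hA⟩ := exists_homotopy_retract_lineMap hU hR z z' hα hα'
  obtain ⟨B, hB⟩ := exists_homotopy_retract_lineMap hV hR z z' hβ hβ'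
  by_contra! hdisj
  refine h ((algebraicIntersectionNumber_eq_of_homotopy A B ?_).trans
    (algebraicIntersectionNumber_eq_zero_of_disjoint ?_))
  · rintro τ s t hst hAB
    rw [hA, hB] at hAB
    rcases hst with rfl | rfl | rfl | rfl
    · exact ha₀ τ ⟨_, Subtype.coe_prop _, by simpa using hAB.symm⟩
    · exact ha₁ τ ⟨_, Subtype.coe_prop _, by simpa using hAB.symm⟩
    · exact hb₀ τ ⟨_, Subtype.coe_prop _, by simpa using hAB⟩
    · exact hb₁ τ ⟨_, Subtype.coe_prop _, by simpa using hAB⟩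
  · rw [disjoint_iff_forall_ne]
    rintro _ ⟨s, rfl⟩ _ ⟨t, rfl⟩
    exact hdisj s t

theorem eventually_pathsCross_of_algebraicIntersectionNumber_ne_zero (hU : Continuous ↿U)
    (hV : Continuous ↿V) (hD : IsCompact D) {R : C(E, D)} (hR : ∀ x : D, R x = x) {z : P}
    {a₀ a₁ b₀ b₁ : E} {α : Path a₀ a₁} {β : Path b₀ b₁} (hα : range α ⊆ D) (hβ : range β ⊆ D)
    (ha₀ : U z a₀ ∉ V z '' D) (ha₁ : U z a₁ ∉ V z '' D) (hb₀ : V z b₀ ∉ U z '' D)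
    (hb₁ : V z b₁ ∉ U z '' D)
    (h : algebraicIntersectionNumber (α.map (hU.uncurry_left z)) (β.map (hV.uncurry_left z)) ≠ 0) :
    ∀ᶠ w : P × (E × E) × E × E in 𝓝 (z, (a₀, a₁), b₀, b₁),
      PathsCross (U w.1) (V w.1) D w.2.1 w.2.2 := by
  have hproj {π : (E × E) × E × E → E} (hπ : Continuous π) :
      Tendsto (fun w : P × (E × E) × E × E => (w.1, π w.2)) (𝓝 (z, (a₀, a₁), b₀, b₁))
        (𝓝 (z, π ((a₀, a₁), b₀, b₁))) :=
    Continuous.tendsto (by fun_prop) _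
  have hmem {x y : E} {γ : Path x y} (hγ : range γ ⊆ D) : x ∈ D ∧ y ∈ D :=
    ⟨hγ ⟨0, γ.source⟩, hγ ⟨1, γ.target⟩⟩
  have hUV {x : E} (hx : x ∈ D) := eventually_forall_lineMap_notMem_image hU hV hD hR (z := z) hx
  have hVU {x : E} (hx : x ∈ D) := eventually_forall_lineMap_notMem_image hV hU hD hR (z := z) hx
  filter_upwards [
    (hproj (π := fun c => c.1.1) (by fun_prop)).eventually (hUV (hmem hα).1 ha₀),
    (hproj (π := fun c => c.1.2) (by fun_prop)).eventually (hUV (hmem hα).2 ha₁),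
    (hproj (π := fun c => c.2.1) (by fun_prop)).eventually (hVU (hmem hβ).1 hb₀),
    (hproj (π := fun c => c.2.2) (by fun_prop)).eventually (hVU (hmem hβ).2 hb₁)]
    with w h₀ h₁ h₂ h₃
  exact pathsCross_of_lineMap_notMem_image hU hV hR hα hβ h₀ h₁ h₂ h₃ h

end Stability

/-! ### Closed topological disks -/

theorem IsClosedTopologicalDisk.isCompact {D : Set ℂ} (hD : IsClosedTopologicalDisk D) :
    IsCompact D := by
  obtain ⟨h⟩ := hD
  have : CompactSpace (closedBall (0 : ℂ) 1) :=
    isCompact_iff_compactSpace.1 (isCompact_closedBall 0 1)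
  exact isCompact_iff_compactSpace.2 h.symm.compactSpace

theorem IsClosedTopologicalDisk.exists_retraction {D : Set ℂ} (hD : IsClosedTopologicalDisk D) :
    ∃ R : C(ℂ, D), ∀ x : D, R x = x := by
  obtain ⟨h⟩ := id hD
  have := Metric.instTietzeExtensionClosedBall ℝ (0 : ℂ) one_pos
  have := TietzeExtension.of_homeo h
  obtain ⟨R, hR⟩ := ContinuousMap.exists_restrict_eq hD.isCompact.isClosed (ContinuousMap.id D)
  exact ⟨R, fun x => DFunLike.congr_fun hR x⟩

/-! ### Self-similar compact sets -/

theorem exists_dist_le_of_mem_cthickening {X : Type*} [PseudoMetricSpace X] {K : Set X}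
    (hK : IsCompact K) {r : ℝ} (hr : 0 ≤ r) {x : X} (hx : x ∈ cthickening r K) :
    ∃ y ∈ K, dist x y ≤ r := by
  simpa [hK.cthickening_eq_biUnion_closedBall hr] using hx

theorem mapsTo_cthickening_of_lipschitzWith {X Y : Type*} [PseudoMetricSpace X]
    [PseudoMetricSpace Y] {f : X → Y} {k : ℝ≥0} (hf : LipschitzWith k f) {K : Set X} {L : Set Y}
    (hK : IsCompact K) (hfK : MapsTo f K L) {r : ℝ} (hr : 0 ≤ r) :
    MapsTo f (cthickening r K) (cthickening (k * r) L) := fun x hx => by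
  obtain ⟨y, hy, hxy⟩ := exists_dist_le_of_mem_cthickening hK hr hx
  exact mem_cthickening_of_dist_le _ _ _ _ (hfK hy) (hf.dist_le_mul_of_le hxy)

theorem isPreconnected_of_forall_joinedIn_thickening {X : Type*} [MetricSpace X] {K : Set X}
    (hK : IsCompact K) (h : ∀ r > 0, ∀ x ∈ K, ∀ y ∈ K, JoinedIn (thickening r K) x y) :
    IsPreconnected K := by
  refine isPreconnected_closed_iff.2 ?_
  rintro A B hA hB hAB ⟨x, hx, hxA⟩ ⟨y, hy, hyB⟩
  by_contra hempty
  have hdisj : Disjoint (K ∩ A) (K ∩ B) :=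
    disjoint_left.2 fun w hw hw' => hempty ⟨w, hw.1, hw.2, hw'.2⟩
  obtain ⟨r, hr, hthick⟩ := hdisj.exists_thickenings (hK.inter_right hA) (hK.isClosed.inter hB)
  obtain ⟨γ, hγ⟩ := h r hr x hx y hy
  have hcover : range γ ⊆ thickening r (K ∩ A) ∪ thickening r (K ∩ B) := by
    rw [← thickening_union, ← inter_union_distrib_left, inter_eq_left.2 hAB]
    exact range_subset_iff.2 hγ
  obtain ⟨w, -, hwA, hwB⟩ := isPreconnected_range γ.continuous _ _ isOpen_thickening
    isOpen_thickening hcover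
    ⟨x, ⟨0, γ.source⟩, self_subset_thickening hr _ ⟨hx, hxA⟩⟩
    ⟨y, ⟨1, γ.target⟩, self_subset_thickening hr _ ⟨hy, hyB⟩⟩
  exact disjoint_left.1 hthick hwA hwB

theorem exists_dist_image_le_of_pathsCross {X Y : Type*} [PseudoMetricSpace X]
    [PseudoMetricSpace Y] {U V : X → Y} {k : ℝ≥0} (hU : LipschitzWith k U) (hV : LipschitzWith k V)
    {K : Set X} (hK : IsCompact K) {r : ℝ} (hr : 0 ≤ r)
    (hjoin : ∀ x ∈ K, ∀ y ∈ K, JoinedIn (cthickening r K) x y) {a b : X × X} (ha : a ∈ K ×ˢ K)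
    (hb : b ∈ K ×ˢ K) (hcross : PathsCross U V (cthickening r K) a b) :
    ∃ x ∈ U '' K, ∃ y ∈ V '' K, dist x y ≤ k * (2 * r) := by
  obtain ⟨α, hα⟩ := hjoin _ ha.1 _ ha.2
  obtain ⟨β, hβ⟩ := hjoin _ hb.1 _ hb.2
  obtain ⟨s, t, hst⟩ := hcross α β (range_subset_iff.2 hα) (range_subset_iff.2 hβ)
  obtain ⟨x, hx, hxs⟩ := exists_dist_le_of_mem_cthickening hK hr (hα s)
  obtain ⟨y, hy, hyt⟩ := exists_dist_le_of_mem_cthickening hK hr (hβ t)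
  refine ⟨_, mem_image_of_mem U hx, _, mem_image_of_mem V hy, ?_⟩
  calc dist (U x) (V y) ≤ dist (U (α s)) (U x) + dist (U (α s)) (V y) := dist_triangle_left _ _ _
    _ = dist (U (α s)) (U x) + dist (V (β t)) (V y) := by rw [hst]
    _ ≤ k * r + k * r := add_le_add (hU.dist_le_mul_of_le hxs) (hV.dist_le_mul_of_le hyt)
    _ = k * (2 * r) := by ring

section SelfSimilar

variable {E : Type*} [NormedAddCommGroup E] [NormedSpace ℝ E] {K : Set E} {F G : E → E} {k : ℝ≥0}
  {p q : E}

theorem joinedIn_cthickening_half_of_dist_le {r : ℝ} {x y : E} (hx : x ∈ K) (hy : y ∈ K)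
    (h : dist x y ≤ r) : JoinedIn (cthickening (r / 2) K) x y := by
  refine JoinedIn.of_segment_subset fun w hw => ?_
  have hadd := dist_add_dist_of_mem_segment hw
  rcases le_total (dist x w) (dist w y) with hle | hle
  · exact mem_cthickening_of_dist_le w x _ _ hx (by rw [dist_comm]; linarith)
  · exact mem_cthickening_of_dist_le w y _ _ hy (by linarith)

theorem joinedIn_cthickening_half_of_image_union_image_eq (hF : LipschitzWith k F)
    (hG : LipschitzWith k G) (hK : IsCompact K) (hFG : F '' K ∪ G '' K = K) (hp : p ∈ F '' K)
    (hq : q ∈ G '' K) {r s : ℝ} (hpq : dist p q ≤ s) (hr : 0 ≤ r) (hrs : k * r ≤ s)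
    (h : ∀ x ∈ K, ∀ y ∈ K, JoinedIn (cthickening (r / 2) K) x y) :
    ∀ x ∈ K, ∀ y ∈ K, JoinedIn (cthickening (s / 2) K) x y := by
  have himage {H : E → E} (hH : LipschitzWith k H) (hHK : H '' K ⊆ K) {x y : E}
      (hx : x ∈ H '' K) (hy : y ∈ H '' K) : JoinedIn (cthickening (s / 2) K) x y := by
    obtain ⟨x, hx, rfl⟩ := hx
    obtain ⟨y, hy, rfl⟩ := hy
    refine ((h x hx y hy).map hH.continuous).mono (image_subset_iff.2 ?_)
    exact (mapsTo_cthickening_of_lipschitzWith hH hK (mapsTo_iff_image_subset.2 hHK)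
      (by positivity)).mono_right (cthickening_mono (by linarith) _)
  have hFK : F '' K ⊆ K := subset_union_left.trans hFG.subset
  have hGK : G '' K ⊆ K := subset_union_right.trans hFG.subset
  have hhop : JoinedIn (cthickening (s / 2) K) p q :=
    joinedIn_cthickening_half_of_dist_le (hFK hp) (hGK hq) hpq
  intro x hx y hy
  rcases hFG.superset hx with hx | hx <;> rcases hFG.superset hy with hy | hy
  · exact himage hF hFK hx hy
  · exact ((himage hF hFK hx hp).trans hhop).trans (himage hG hGK hq hy)
  · exact ((himage hG hGK hx hq).trans hhop.symm).trans (himage hF hFK hp hy)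
  · exact himage hG hGK hx hy

theorem joinedIn_cthickening_half (hF : ContractingWith k F) (hG : ContractingWith k G)
    (hK : IsCompact K) (hFG : F '' K ∪ G '' K = K) (hp : p ∈ F '' K) (hq : q ∈ G '' K) {δ : ℝ}
    (hδ : 0 < δ) (hpq : dist p q ≤ δ) :
    ∀ x ∈ K, ∀ y ∈ K, JoinedIn (cthickening (δ / 2) K) x y := by
  have hiter (n : ℕ) : ∀ x ∈ K, ∀ y ∈ K,
      JoinedIn (cthickening (max δ (k ^ n * diam K) / 2) K) x y := by
    induction n with
    | zero =>
      exact fun x hx y hy => joinedIn_cthickening_half_of_dist_le hx hy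
        (le_max_of_le_right (by simpa using dist_le_diam_of_mem hK.isBounded hx hy))
    | succ n ih =>
      refine joinedIn_cthickening_half_of_image_union_image_eq hF.toLipschitzWith
        hG.toLipschitzWith hK hFG hp hq (hpq.trans (le_max_left _ _))
        (hδ.le.trans (le_max_left _ _)) ?_ ih
      rw [mul_max_of_nonneg _ _ k.coe_nonneg, ← mul_assoc, ← pow_succ']
      exact max_le_max_right _ (mul_le_of_le_one_left hδ.le hF.1.le)
  have hlim : Tendsto (fun n => (k : ℝ) ^ n * diam K) atTop (𝓝 0) := by
    simpa using (tendsto_pow_atTop_nhds_zero_of_lt_one k.coe_nonneg hF.1).mul_const (diam K)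
  obtain ⟨n, hn⟩ := (hlim.eventually_lt_const hδ).exists
  simpa only [max_eq_left hn.le] using hiter n

theorem isConnected_of_image_inter_nonempty (hF : ContractingWith k F) (hG : ContractingWith k G)
    (hK : IsCompact K) (hFG : F '' K ∪ G '' K = K) (hne : (F '' K ∩ G '' K).Nonempty) :
    IsConnected K := by
  obtain ⟨p, hpF, hpG⟩ := hne
  refine ⟨⟨p, hFG.subset (Or.inl hpF)⟩,
    isPreconnected_of_forall_joinedIn_thickening hK fun r hr x hx y hy => ?_⟩
  exact (joinedIn_cthickening_half hF hG hK hFG hpF hpG hr (by simpa using hr.le) x hx y hy).mono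
    (cthickening_subset_thickening' hr (half_lt_self hr) K)

theorem image_inter_nonempty_of_pathsCross (hF : ContractingWith k F) (hG : ContractingWith k G)
    (hK : IsCompact K) (hFG : F '' K ∪ G '' K = K) {U V : E → E} (hU : LipschitzWith k U)
    (hV : LipschitzWith k V) (hUF : U '' K ⊆ F '' K) (hVG : V '' K ⊆ G '' K) {D : Set E}
    {a b : E × E} (ha : a ∈ K ×ˢ K) (hb : b ∈ K ×ˢ K) (hcross : PathsCross U V D a b)
    (hp : p ∈ F '' K) (hq : q ∈ G '' K) (hD : cthickening (dist p q / 2) K ⊆ D) :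
    (F '' K ∩ G '' K).Nonempty := by
  obtain ⟨⟨x, y⟩, ⟨hx, hy⟩, hmin⟩ := ((hK.image hF.toLipschitzWith.continuous).prod
    (hK.image hG.toLipschitzWith.continuous)).exists_isMinOn ⟨(p, q), hp, hq⟩
    continuous_dist.continuousOn
  have hle : ∀ x' ∈ F '' K, ∀ y' ∈ G '' K, dist x y ≤ dist x' y' :=
    fun x' hx' y' hy' => hmin (mk_mem_prod hx' hy')
  by_contra hempty
  have hpos : 0 < dist x y := dist_pos.2 fun hxy => hempty ⟨x, hx, hxy ▸ hy⟩
  have hxyD : cthickening (dist x y / 2) K ⊆ D :=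
    (cthickening_mono (by linarith [hle p hp q hq]) K).trans hD
  obtain ⟨x', hx', y', hy', hlt⟩ := exists_dist_image_le_of_pathsCross hU hV hK (half_pos hpos).le
    (joinedIn_cthickening_half hF hG hK hFG hx hy hpos le_rfl) ha hb (hcross.mono hxyD)
  have hcontr : k * dist x y < dist x y := mul_lt_of_lt_one_left hpos hF.1
  linarith [hle x' (hUF hx') y' (hVG hy'), mul_div_cancel₀ (dist x y) (two_ne_zero (α := ℝ))]

end SelfSimilar

/-! ### Hemicontinuous set-valued maps -/

theorem lowerHemicontinuousAt_prod {Z X Y : Type*} [TopologicalSpace Z] [TopologicalSpace X]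
    [TopologicalSpace Y] {Φ : Z → Set X} {Ψ : Z → Set Y} {z : Z} (hΦ : LowerHemicontinuousAt Φ z)
    (hΨ : LowerHemicontinuousAt Ψ z) : LowerHemicontinuousAt (fun z => Φ z ×ˢ Ψ z) z := by
  refine lowerHemicontinuousAt_iff.2 fun S hS ⟨⟨x, y⟩, ⟨hx, hy⟩, hxyS⟩ => ?_
  obtain ⟨A, B, hA, hB, hxA, hyB, hAB⟩ := isOpen_prod_iff.1 hS x y hxyS
  filter_upwards [lowerHemicontinuousAt_iff.1 hΦ A hA ⟨x, hx, hxA⟩,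
    lowerHemicontinuousAt_iff.1 hΨ B hB ⟨y, hy, hyB⟩] with z' ⟨x', hx', hxA'⟩ ⟨y', hy', hyB'⟩
  exact ⟨(x', y'), ⟨hx', hy'⟩, hAB ⟨hxA', hyB'⟩⟩

theorem eventually_exists_mem_of_lowerHemicontinuousAt {Z X : Type*} [TopologicalSpace Z]
    [TopologicalSpace X] {Φ : Z → Set X} {z : Z} (hΦ : LowerHemicontinuousAt Φ z) {x : X}
    (hx : x ∈ Φ z) {p : Z × X → Prop} (hp : ∀ᶠ w in 𝓝 (z, x), p w) :
    ∀ᶠ z' in 𝓝 z, ∃ x' ∈ Φ z', p (z', x') := by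
  obtain ⟨A, hA, B, hB, hAB⟩ := mem_nhds_prod_iff.1 hp
  filter_upwards [hA, lowerHemicontinuousAt_iff.1 hΦ _ isOpen_interior
    ⟨x, hx, mem_interior_iff_mem_nhds.2 hB⟩] with z' hz' ⟨x', hx', hxB⟩
  exact ⟨x', hx', hAB ⟨hz', interior_subset hxB⟩⟩

theorem exists_eventually_cthickening_subset_of_upperHemicontinuousAt {Z X : Type*}
    [TopologicalSpace Z] [PseudoMetricSpace X] {Φ : Z → Set X} {z : Z}
    (hΦ : UpperHemicontinuousAt Φ z) (hc : IsCompact (Φ z)) {S : Set X} (hS : IsOpen S)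
    (hsub : Φ z ⊆ S) : ∃ η > 0, ∀ᶠ z' in 𝓝 z, cthickening η (Φ z') ⊆ S := by
  obtain ⟨η, hη, hηS⟩ := hc.exists_cthickening_subset_open hS hsub
  refine ⟨η / 2, half_pos hη, ?_⟩
  filter_upwards [upperHemicontinuousAt_iff_forall_isOpen.1 hΦ (thickening (η / 2) (Φ z))
    isOpen_thickening (self_subset_thickening (half_pos hη) _)] with z' hz'
  calc cthickening (η / 2) (Φ z') ⊆ cthickening (η / 2) (thickening (η / 2) (Φ z)) :=
        cthickening_subset_of_subset _ hz'
    _ ⊆ cthickening (η / 2 + η / 2) (Φ z) :=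
        cthickening_thickening_subset (half_pos hη).le _ _
    _ ⊆ S := by rwa [add_halves]

/-! ### The generators and their compositions -/

section WordMap

variable (z : ℂ) (a : Letter) (w w' : List Letter) (x y : ℂ)

theorem gen_sub : gen z a x - gen z a y = z * (x - y) := by
  cases a <;> simp only [gen] <;> ring

theorem continuous_gen : Continuous fun p : ℂ × ℂ => gen p.1 a p.2 := by
  cases a <;> simp only [gen] <;> fun_prop

theorem wordMap_append : wordMap z (w ++ w') x = wordMap z w (wordMap z w' x) := by
  induction w with
  | nil => rfl
  | cons a w ih => exact congrArg (gen z a) ih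

theorem wordMap_sub : wordMap z w x - wordMap z w y = z ^ w.length * (x - y) := by
  induction w with
  | nil => simp [wordMap]
  | cons a w ih =>
    change gen z a (wordMap z w x) - gen z a (wordMap z w y) = _
    rw [gen_sub, ih, List.length_cons]
    ring

theorem wordMap_eq : wordMap z w x = z ^ w.length * x + wordMap z w 0 := by
  linear_combination wordMap_sub z w x 0

theorem continuous_wordMap : Continuous fun p : ℂ × ℂ => wordMap p.1 w p.2 := by
  induction w with
  | nil => exact continuous_snd
  | cons a w ih => exact (continuous_gen a).comp (continuous_fst.prodMk ih)

theorem lipschitzWith_wordMap : LipschitzWith (‖z‖₊ ^ w.length) (wordMap z w) :=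
  LipschitzWith.of_dist_le_mul fun x y => by
    rw [dist_eq_norm, wordMap_sub, norm_mul, norm_pow, dist_eq_norm]
    simp

end WordMap

theorem contractingWith_gen {z : ℂ} (hz : ‖z‖ < 1) (a : Letter) :
    ContractingWith ‖z‖₊ (gen z a) :=
  ⟨hz, by simpa [wordMap] using lipschitzWith_wordMap z [a]⟩

theorem isEmbedding_wordMap {z : ℂ} (hz : z ≠ 0) (w : List Letter) : IsEmbedding (wordMap z w) := by
  convert ((Homeomorph.mulLeft₀ (z ^ w.length) (pow_ne_zero _ hz)).trans
    (Homeomorph.addRight (wordMap z w 0))).isEmbedding using 1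
  exact funext (wordMap_eq z w)

theorem one_sub_pow_ne_zero {𝕜 : Type*} [NormedDivisionRing 𝕜] {z : 𝕜} (hz : ‖z‖ < 1) {n : ℕ}
    (hn : n ≠ 0) : 1 - z ^ n ≠ 0 := by
  refine sub_ne_zero.2 fun h => (pow_lt_one₀ (norm_nonneg z) hz hn).ne ?_
  rw [← norm_pow, ← h, norm_one]

/-- The fixed point of the affine map `x ↦ z ^ n * x + w(z, 0)` attached to a word `w` of
length `n`; it is the junk value `0` if `z ^ n = 1`. -/
noncomputable def wordFixedPoint (z : ℂ) (w : List Letter) : ℂ :=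
  wordMap z w 0 / (1 - z ^ w.length)

theorem wordMap_eq_self_iff {z : ℂ} {w : List Letter} (hw : 1 - z ^ w.length ≠ 0) {x : ℂ} :
    wordMap z w x = x ↔ wordFixedPoint z w = x := by
  rw [wordFixedPoint, div_eq_iff hw, wordMap_eq]
  constructor <;> intro h <;> linear_combination h

theorem wordFixedPoint_mem_limitSet {z : ℂ} (hz : ‖z‖ < 1) {w : List Letter} (hw : w ≠ []) :
    wordFixedPoint z w ∈ limitSet z :=
  subset_closure ⟨w, hw, (wordMap_eq_self_iff
    (one_sub_pow_ne_zero hz (List.length_pos_iff.2 hw).ne')).2 rfl⟩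

theorem continuousAt_wordFixedPoint {z : ℂ} (hz : ‖z‖ < 1) {w : List Letter} (hw : w ≠ []) :
    ContinuousAt (fun z' => wordFixedPoint z' w) z := by
  have hnum : Continuous fun z' => wordMap z' w 0 :=
    (continuous_wordMap w).comp (f := fun z' : ℂ => (z', (0 : ℂ))) (by fun_prop)
  exact hnum.continuousAt.div (by fun_prop)
    (one_sub_pow_ne_zero hz (List.length_pos_iff.2 hw).ne')

/-! ### The limit set -/

section LimitSet

variable {z : ℂ}

theorem zero_mem_limitSet (z : ℂ) : (0 : ℂ) ∈ limitSet z :=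
  subset_closure ⟨[Letter.f], by simp, by simp [wordMap, gen]⟩

theorem mem_limitSet_of_tendsto_wordMap (hz : ‖z‖ < 1) {W : ℕ → List Letter}
    (hW : Tendsto (fun n => (W n).length) atTop atTop) {x y : ℂ}
    (hx : Tendsto (fun n => wordMap z (W n) y) atTop (𝓝 x)) : x ∈ limitSet z := by
  have hpow : Tendsto (fun n => z ^ (W n).length) atTop (𝓝 0) :=
    (tendsto_pow_atTop_nhds_zero_of_norm_lt_one hz).comp hW
  have hfix : Tendsto (fun n => wordFixedPoint z (W n)) atTop (𝓝 x) := by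
    have := (hx.sub (hpow.mul_const y)).div (hpow.const_sub 1) (by simp)
    simpa [wordFixedPoint, wordMap_eq z _ y, Pi.div_def] using this
  refine isClosed_closure.mem_of_tendsto hfix ?_
  filter_upwards [hW.eventually_gt_atTop 0] with n hn
  exact wordFixedPoint_mem_limitSet hz (List.length_pos_iff.1 hn)

theorem tendsto_wordMap_flatten_replicate (hz : ‖z‖ < 1) {w : List Letter} (hw : w ≠ []) {x : ℂ}
    (hx : wordMap z w x = x) (y : ℂ) :
    Tendsto (fun n => wordMap z (List.replicate n w).flatten y) atTop (𝓝 x) := by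
  have hfix (n : ℕ) : wordMap z (List.replicate n w).flatten x = x := by
    induction n with
    | zero => rfl
    | succ n ih => rw [List.replicate_succ, List.flatten_cons, wordMap_append, ih, hx]
  have hpow : Tendsto (fun n => (z ^ w.length) ^ n) atTop (𝓝 0) :=
    tendsto_pow_atTop_nhds_zero_of_norm_lt_one <| by
      rw [norm_pow]
      exact pow_lt_one₀ (norm_nonneg z) hz (List.length_pos_iff.2 hw).ne'
  have hlim := (hpow.mul_const (y - x)).const_add x
  rw [zero_mul, add_zero] at hlim
  refine hlim.congr fun n => ?_
  have hsub := wordMap_sub z (List.replicate n w).flatten y x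
  rw [hfix, List.length_flatten, List.map_replicate, List.sum_replicate, smul_eq_mul, mul_comm n,
    pow_mul] at hsub
  linear_combination -hsub

theorem limitSet_subset_of_mapsTo (hz : ‖z‖ < 1) {N : Set ℂ} (hN : IsClosed N) (hne : N.Nonempty)
    (h : ∀ a, MapsTo (gen z a) N N) : limitSet z ⊆ N := by
  obtain ⟨y, hy⟩ := hne
  have hword (w : List Letter) : wordMap z w y ∈ N := by
    induction w with
    | nil => exact hy
    | cons a w ih => exact h a ih
  refine closure_minimal ?_ hN
  rintro x ⟨w, hw, hx⟩
  exact hN.mem_of_tendsto (tendsto_wordMap_flatten_replicate hz hw hx y)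
    (Eventually.of_forall fun n => hword _)

theorem mapsTo_gen_limitSet (hz : ‖z‖ < 1) (a : Letter) :
    MapsTo (gen z a) (limitSet z) (limitSet z) := by
  have hcont := (contractingWith_gen hz a).toLipschitzWith.continuous
  refine fun x hx => closure_minimal ?_ (isClosed_closure.preimage hcont) hx
  rintro x ⟨w, hw, hx⟩
  refine mem_limitSet_of_tendsto_wordMap hz (W := fun n => a :: (List.replicate n w).flatten) ?_
    ((hcont.tendsto x).comp (tendsto_wordMap_flatten_replicate hz hw hx 0))
  refine tendsto_atTop_mono (fun n => ?_) tendsto_id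
  have : n * 1 ≤ n * w.length := Nat.mul_le_mul_left n (List.length_pos_iff.2 hw)
  simp only [id, List.length_cons, List.length_flatten, List.map_replicate, List.sum_replicate,
    smul_eq_mul]
  lia

theorem mapsTo_wordMap_limitSet (hz : ‖z‖ < 1) (w : List Letter) :
    MapsTo (wordMap z w) (limitSet z) (limitSet z) := by
  induction w with
  | nil => exact mapsTo_id _
  | cons a w ih => exact (mapsTo_gen_limitSet hz a).comp ih

theorem isCompact_limitSet (hz : ‖z‖ < 1) : IsCompact (limitSet z) := by
  have hpos : 0 < 1 - ‖z‖ := sub_pos.2 hz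
  refine (isCompact_closedBall (0 : ℂ) (‖1 - z‖ / (1 - ‖z‖))).of_isClosed_subset
    isClosed_closure (limitSet_subset_of_mapsTo hz isClosed_closedBall
      ⟨0, mem_closedBall_self (by positivity)⟩ fun a x hx => ?_)
  rw [mem_closedBall_zero_iff] at hx ⊢
  have hgen : ‖gen z a x‖ ≤ ‖z‖ * ‖x‖ + ‖1 - z‖ := by
    cases a with
    | f => simp [gen]
    | g =>
      rw [← norm_mul, show gen z Letter.g x = z * x + (1 - z) by simp only [gen]; ring]
      exact norm_add_le _ _
  calc ‖gen z a x‖ ≤ ‖z‖ * (‖1 - z‖ / (1 - ‖z‖)) + ‖1 - z‖ := hgen.trans (by gcongr)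
    _ = ‖1 - z‖ / (1 - ‖z‖) := by field_simp; ring

theorem image_gen_union_image_gen_limitSet (hz : ‖z‖ < 1) :
    gen z Letter.f '' limitSet z ∪ gen z Letter.g '' limitSet z = limitSet z := by
  have hmaps := mapsTo_gen_limitSet hz
  have hclosed (a : Letter) : IsClosed (gen z a '' limitSet z) :=
    ((isCompact_limitSet hz).image (contractingWith_gen hz a).toLipschitzWith.continuous).isClosed
  have hsub : gen z Letter.f '' limitSet z ∪ gen z Letter.g '' limitSet z ⊆ limitSet z :=
    union_subset (hmaps _).image_subset (hmaps _).image_subset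
  refine hsub.antisymm (limitSet_subset_of_mapsTo hz ((hclosed _).union (hclosed _))
    ((nonempty_of_mem (zero_mem_limitSet z)).image _).inl fun a x hx => ?_)
  cases a with
  | f => exact Or.inl (mem_image_of_mem _ (hsub hx))
  | g => exact Or.inr (mem_image_of_mem _ (hsub hx))

/-! ### Dependence of the limit set on the parameter -/

theorem lowerHemicontinuousAt_limitSet (hz : ‖z‖ < 1) : LowerHemicontinuousAt limitSet z := by
  refine lowerHemicontinuousAt_iff.2 fun S hS ⟨x, hx, hxS⟩ => ?_
  obtain ⟨y, hyS, w, hw, hy⟩ := mem_closure_iff.1 hx S hS hxS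
  obtain rfl := (wordMap_eq_self_iff
    (one_sub_pow_ne_zero hz (List.length_pos_iff.2 hw).ne')).1 hy
  filter_upwards [(continuousAt_wordFixedPoint hz hw).eventually (hS.mem_nhds hyS),
    continuous_norm.continuousAt.eventually_lt_const hz] with z' hz'S hz'
  exact ⟨_, wordFixedPoint_mem_limitSet hz' hw, hz'S⟩

theorem upperHemicontinuousAt_limitSet (hz : ‖z‖ < 1) : UpperHemicontinuousAt limitSet z := by
  have hc := isCompact_limitSet hz
  refine upperHemicontinuousAt_iff_forall_isOpen.2 fun S hS hsub => ?_
  obtain ⟨η, hη, hηS⟩ := hc.exists_cthickening_subset_open hS hsub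
  have hmaps : ∀ a, ∀ᶠ z' in 𝓝 z, MapsTo (gen z' a) (cthickening η (limitSet z))
      (cthickening η (limitSet z)) := fun a => by
    refine hc.cthickening.eventually_forall_of_forall_eventually fun x hx => ?_
    have hgen := mapsTo_cthickening_of_lipschitzWith (contractingWith_gen hz a).toLipschitzWith hc
      (mapsTo_gen_limitSet hz a) hη.le hx
    refine (continuous_gen a).continuousAt.eventually (mem_of_superset
      (isOpen_thickening.mem_nhds ?_) (thickening_subset_cthickening η (limitSet z)))
    exact cthickening_subset_thickening' hη (mul_lt_of_lt_one_left hη hz) _ hgen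
  filter_upwards [hmaps Letter.f, hmaps Letter.g,
    continuous_norm.continuousAt.eventually_lt_const hz] with z' hf hg hz'
  exact (limitSet_subset_of_mapsTo hz' isClosed_cthickening
    ⟨0, self_subset_cthickening _ (zero_mem_limitSet z)⟩
    fun a => match a with
      | Letter.f => hf
      | Letter.g => hg).trans hηS

end LimitSet

/-! ### Crossings forced by a trap -/

section Traps

variable {z : ℂ} {D : Set ℂ} {u v : List Letter}

theorem mem_connectednessLocus_of_image_gen_inter_nonempty (hz₀ : 0 < ‖z‖) (hz₁ : ‖z‖ < 1)
    (hne : (gen z Letter.f '' limitSet z ∩ gen z Letter.g '' limitSet z).Nonempty) :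
    z ∈ connectednessLocus :=
  ⟨hz₀, hz₁, isConnected_of_image_inter_nonempty (contractingWith_gen hz₁ _)
    (contractingWith_gen hz₁ _) (isCompact_limitSet hz₁) (image_gen_union_image_gen_limitSet hz₁)
    hne⟩

theorem image_wordMap_cons_limitSet_subset (hz : ‖z‖ < 1) (a : Letter) (w : List Letter) :
    wordMap z (a :: w) '' limitSet z ⊆ gen z a '' limitSet z :=
  (image_comp (gen z a) (wordMap z w) _).trans_subset
    (image_mono (mapsTo_wordMap_limitSet hz w).image_subset)

theorem lipschitzWith_wordMap_cons (hz : ‖z‖ < 1) (a : Letter) (w : List Letter) :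
    LipschitzWith ‖z‖₊ (wordMap z (a :: w)) :=
  (lipschitzWith_wordMap z (a :: w)).weaken (pow_le_of_le_one zero_le hz.le (by simp))

theorem image_gen_inter_nonempty_of_pathsCross (hz : ‖z‖ < 1) {a b : ℂ × ℂ}
    (ha : a ∈ limitSet z ×ˢ limitSet z) (hb : b ∈ limitSet z ×ˢ limitSet z)
    (hcross : PathsCross (wordMap z (Letter.f :: u)) (wordMap z (Letter.g :: v)) D a b) {p q : ℂ}
    (hp : p ∈ gen z Letter.f '' limitSet z) (hq : q ∈ gen z Letter.g '' limitSet z)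
    (hD : cthickening (dist p q / 2) (limitSet z) ⊆ D) :
    (gen z Letter.f '' limitSet z ∩ gen z Letter.g '' limitSet z).Nonempty :=
  image_inter_nonempty_of_pathsCross (contractingWith_gen hz _) (contractingWith_gen hz _)
    (isCompact_limitSet hz) (image_gen_union_image_gen_limitSet hz)
    (lipschitzWith_wordMap_cons hz _ u) (lipschitzWith_wordMap_cons hz _ v)
    (image_wordMap_cons_limitSet_subset hz _ u) (image_wordMap_cons_limitSet_subset hz _ v)
    ha hb hcross hp hq hD

theorem IsTrap.exists_eventually_pathsCross (htrap : IsTrap z D u v) (hz : z ≠ 0) :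
    ∃ a ∈ limitSet z ×ˢ limitSet z, ∃ b ∈ limitSet z ×ˢ limitSet z,
      ∀ᶠ w : ℂ × (ℂ × ℂ) × ℂ × ℂ in 𝓝 (z, a, b),
        PathsCross (wordMap w.1 u) (wordMap w.1 v) D w.2.1 w.2.2 := by
  obtain ⟨-, ⟨⟨a₀, ha₀, rfl⟩, hpm⟩, -, ⟨⟨a₁, ha₁, rfl⟩, hpp⟩, -, ⟨⟨b₀, hb₀, rfl⟩, hqm⟩,
    -, ⟨⟨b₁, hb₁, rfl⟩, hqp⟩, α, β, hα, hβ, hne⟩ := htrap.crossing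
  obtain ⟨R, hR⟩ := htrap.isDisk.exists_retraction
  obtain ⟨α, hαD, rfl⟩ := exists_path_map_eq_of_isEmbedding (isEmbedding_wordMap hz u) α hα
  obtain ⟨β, hβD, rfl⟩ := exists_path_map_eq_of_isEmbedding (isEmbedding_wordMap hz v) β hβ
  exact ⟨(a₀, a₁), ⟨ha₀, ha₁⟩, (b₀, b₁), ⟨hb₀, hb₁⟩,
    eventually_pathsCross_of_algebraicIntersectionNumber_ne_zero
      (U := fun z => wordMap z u) (V := fun z => wordMap z v) (continuous_wordMap u)
      (continuous_wordMap v) htrap.isDisk.isCompact hR hαD hβD hpm hpp hqm hqp hne⟩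

theorem IsTrap.image_gen_inter_nonempty (htrap : IsTrap z D u v) (hz₀ : z ≠ 0) (hz₁ : ‖z‖ < 1) :
    (gen z Letter.f '' limitSet z ∩ gen z Letter.g '' limitSet z).Nonempty := by
  obtain ⟨a, ha, b, hb, hcross⟩ := htrap.exists_eventually_pathsCross hz₀
  obtain ⟨u, rfl⟩ := htrap.left_start
  obtain ⟨v, rfl⟩ := htrap.right_start
  obtain ⟨ε, hε, hsub, p, hp, q, hq, hpq⟩ := htrap.close
  refine image_gen_inter_nonempty_of_pathsCross hz₁ ha hb hcross.self_of_nhds hp hq ?_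
  calc cthickening (dist p q / 2) (limitSet z) ⊆ cthickening (ε / 2) (limitSet z) :=
        cthickening_mono (by linarith) _
    _ = closure (thickening (ε / 2) (limitSet z)) := (closure_thickening (half_pos hε) _).symm
    _ ⊆ D := closure_minimal hsub htrap.isDisk.isCompact.isClosed

theorem IsTrap.eventually_image_gen_inter_nonempty (htrap : IsTrap z D u v) (hz₀ : z ≠ 0)
    (hz₁ : ‖z‖ < 1) :
    ∀ᶠ z' in 𝓝 z, (gen z' Letter.f '' limitSet z' ∩ gen z' Letter.g '' limitSet z').Nonempty := by
  obtain ⟨p, ⟨x, hx, hxp⟩, ⟨y, hy, hyp⟩⟩ := htrap.image_gen_inter_nonempty hz₀ hz₁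
  obtain ⟨a, ha, b, hb, hcross⟩ := htrap.exists_eventually_pathsCross hz₀
  obtain ⟨u, rfl⟩ := htrap.left_start
  obtain ⟨v, rfl⟩ := htrap.right_start
  obtain ⟨η, hη, hηD⟩ := exists_eventually_cthickening_subset_of_upperHemicontinuousAt
    (upperHemicontinuousAt_limitSet hz₁) (isCompact_limitSet hz₁) isOpen_interior
    htrap.limitSet_subset
  have hΛ := lowerHemicontinuousAt_limitSet hz₁
  have hΛΛ := lowerHemicontinuousAt_prod hΛ hΛ
  have hclose : ∀ᶠ w : ℂ × ℂ × ℂ in 𝓝 (z, x, y),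
      dist (gen w.1 Letter.f w.2.1) (gen w.1 Letter.g w.2.2) < 2 * η := by
    refine Continuous.tendsto' (by simp only [gen]; fun_prop) _ 0 ?_ |>.eventually_lt_const
      (by positivity)
    simp [hxp, hyp]
  filter_upwards [continuous_norm.continuousAt.eventually_lt_const hz₁, hηD,
    eventually_exists_mem_of_lowerHemicontinuousAt (lowerHemicontinuousAt_prod hΛΛ hΛΛ)
      (mk_mem_prod ha hb) hcross,
    eventually_exists_mem_of_lowerHemicontinuousAt hΛΛ (mk_mem_prod hx hy) hclose]
    with z' hz' hsub ⟨c, hc, hcross'⟩ ⟨d, hd, hdist⟩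
  refine image_gen_inter_nonempty_of_pathsCross hz' hc.1 hc.2 hcross' (mem_image_of_mem _ hd.1)
    (mem_image_of_mem _ hd.2) ?_
  exact (cthickening_mono (by linarith) _).trans (hsub.trans interior_subset)

end Traps

end IFSTraps

theorem mainTheorem7 (z : ℂ) (hz_pos : 0 < ‖z‖) (hz_lt : ‖z‖ < 1)
    (D : Set ℂ) (u v : List IFSTraps.Letter) (htrap : IFSTraps.IsTrap z D u v) :
    z ∈ interior IFSTraps.connectednessLocus := by
  rw [mem_interior_iff_mem_nhds]
  filter_upwards [htrap.eventually_image_gen_inter_nonempty (norm_pos_iff.1 hz_pos) hz_lt,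
    continuous_norm.continuousAt.eventually_lt_const hz_lt,
    continuous_norm.continuousAt.eventually_const_lt hz_pos] with z' hinter hlt hpos
  exact IFSTraps.mem_connectednessLocus_of_image_gen_inter_nonempty hpos hlt hinter
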